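/- There are absolute constants $C, C', q > 0$ such that the following holds for all integers $n \ge 0$ and $1 \le k \le d$ and all reals $p \ge 1$, $0<\varepsilon<1$, $0\le\alpha\le 1$. Let $x_1,\dots,x_n\in\mathbb{R}^d$. For a linear subspace $V\subseteq\mathbb{R}^d$ let $d(x,V)$ be the Euclidean distance, and let $N_\alpha(V)\subseteq[n]$ denote a set of indices of the $\lceil(1-\alpha)n\rceil$ points nearest to $V$ (ties broken arbitrarily). Let $V^*$ be a $k$-dimensional linear subspace that minimizes $\sum_{i\in N_\alpha(V)}d(x_i,V)^p$ over all $k$-dimensional linear subspaces $V$, and let $I=N_\alpha(V^*)$ be its set of inliers. Put $N=\lceil C\,\frac{p^2k}{\varepsilon^2}\log\frac{2k}{\varepsilon}\rceil$ and draw index sets $S_1,\dots,S_k\subseteq[n]$ in $k$ rounds: given $S_1,\dots,S_{t-1}$, the set $S_t$ consists of $N$ i.i.d. indices, each equal to $i$ with probability proportional to $d\bigl(x_i,\operatorname{span}\{x_j: j\in S_1\cup\dots\cup S_{t-1}\}\bigr)^p$ (so proportional to $\|x_i\|^p$ in the first round); if all these distances are $0$, then $S_t=\emptyset$. Let $S=S_1\cup\dots\cup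 S_k$. The total number of points drawn is at most $kN\le C'\,\frac{p^2k^2}{\varepsilon^2}\log\frac{2k}{\varepsilon}$. With probability at least $q$, the space $\operatorname{span}\{x_i: i\in S\}$ contains a linear subspace $V_S$ of dimension $\min\{k,\dim\operatorname{span}\{x_1,\dots,x_n\}\}$ (thus of dimension $k$ as soon as the points span at least $k$ dimensions) such that $$\sum_{i\in I}d(x_i,V_S)^p\;\le\;\sum_{i\in I}d(x_i,V^*)^p+\varepsilon\sum_{i=1}^n\|x_i\|^p .$$ -/

import Mathlib

noncomputable section

namespace SubspaceOutliers

/-- Euclidean space of dimension `d`. -/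
abbrev Pt (d : ℕ) : Type := EuclideanSpace ℝ (Fin d)

variable {n d : ℕ}

/-- Euclidean distance from a point to a linear subspace. -/
def distTo (y : Pt d) (V : Submodule ℝ (Pt d)) : ℝ :=
  Metric.infDist y (V : Set (Pt d))

/-- The linear span of the points `x i` with `i ∈ S`. -/
def spanOf (x : Fin n → Pt d) (S : Finset (Fin n)) : Submodule ℝ (Pt d) :=
  Submodule.span ℝ (x '' (S : Set (Fin n)))

/-- The `ℓ_p` error of the subspace `V`, summed over the points with index in `I`. -/
def lpError (x : Fin n → Pt d) (p : ℝ) (V : Submodule ℝ (Pt d)) (I : Finset (Fin n)) : ℝ :=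
  ∑ i ∈ I, distTo (x i) V ^ p

/-- `I` consists of the indices of the `(1 - α) n` points (rounded up to an integer) that are
nearest to `V`; ties may be broken in any way. -/
def IsNearest (x : Fin n → Pt d) (α : ℝ) (V : Submodule ℝ (Pt d)) (I : Finset (Fin n)) : Prop :=
  I.card = ⌈(1 - α) * (n : ℝ)⌉₊ ∧ ∀ i ∈ I, ∀ j, j ∉ I → distTo (x i) V ≤ distTo (x j) V

/-- `V` is an optimal `k`-dimensional subspace for `ℓ_p` subspace approximation with outlier
parameter `α`, and `I` is its set of inliers. -/
structure IsOptimal (x : Fin n → Pt d) (k : ℕ) (p α : ℝ) (V : Submodule ℝ (Pt d))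
    (I : Finset (Fin n)) : Prop where
  finrank_eq : Module.finrank ℝ V = k
  nearest : IsNearest x α V I
  le_error : ∀ (V' : Submodule ℝ (Pt d)) (I' : Finset (Fin n)),
    Module.finrank ℝ V' = k → IsNearest x α V' I' → lpError x p V I ≤ lpError x p V' I'

/-- The law of `N` independent draws from `q`. -/
def iid {ι : Type} [Fintype ι] (q : PMF ι) (N : ℕ) : PMF (Fin N → ι) :=
  PMF.ofFintype (fun f => ∏ j, q (f j)) (by
    classical
    have h : ∑ i, q i = 1 := by simpa [tsum_fintype] using q.tsum_coe
    have h2 := Finset.prod_univ_sum (fun _ : Fin N => (Finset.univ : Finset ι))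
      (fun _ i => q i)
    rw [Fintype.piFinset_univ] at h2
    rw [← h2]
    simp [h])

/-- The unnormalized weight of index `i` when `S` has been sampled: the `p`-th power of the
distance of `x i` to the span of the sample. -/
def weight (x : Fin n → Pt d) (p : ℝ) (S : Finset (Fin n)) (i : Fin n) : ENNReal :=
  ENNReal.ofReal (distTo (x i) (spanOf x S) ^ p)

theorem tsum_weight_ne_top (x : Fin n → Pt d) (p : ℝ) (S : Finset (Fin n)) :
    ∑' i, weight x p S i ≠ ⊤ := by
  rw [tsum_fintype]
  exact ENNReal.sum_ne_top.mpr fun i _ => ENNReal.ofReal_ne_top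

open Classical in
/-- One round: `N` i.i.d. indices, each drawn with probability proportional to `weight x p S`,
are added to `S`. If all weights vanish (every point lies in the span of the sample already),
nothing is added. -/
def round (x : Fin n → Pt d) (p : ℝ) (N : ℕ) (S : Finset (Fin n)) : PMF (Finset (Fin n)) :=
  if h : ∑' i, weight x p S i = 0 then PMF.pure S
  else (iid (PMF.normalize (weight x p S) h (tsum_weight_ne_top x p S)) N).map
    (fun f => S ∪ Finset.univ.image f)

/-- The law of the set of indices sampled in the first `t` adaptive rounds. In the first round
the span is `0`, so that the weights are `‖x i‖ ^ p`. -/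
def adaptiveSample (x : Fin n → Pt d) (p : ℝ) (N : ℕ) : ℕ → PMF (Finset (Fin n))
  | 0 => PMF.pure ∅
  | t + 1 => (adaptiveSample x p N t).bind (round x p N)

/-- The number of points drawn in each round, with constant `C`. -/
def roundSize (C p : ℝ) (k : ℕ) (ε : ℝ) : ℕ :=
  ⌈C * (p ^ 2 * k / ε ^ 2 * Real.log (2 * k / ε))⌉₊

/-- The sampled set `S` is good for `(V, I)`: the span of the sample contains a subspace of
dimension `k` (or the span of all points, if that has smaller dimension) whose error over `I`
exceeds that of `V` by at most `ε ∑ i, ‖x i‖ ^ p`. -/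
def IsGood (x : Fin n → Pt d) (k : ℕ) (p ε : ℝ) (V : Submodule ℝ (Pt d))
    (I S : Finset (Fin n)) : Prop :=
  ∃ W : Submodule ℝ (Pt d), W ≤ spanOf x S ∧
    Module.finrank ℝ W = min k (Module.finrank ℝ (Submodule.span ℝ (Set.range x))) ∧
    lpError x p W I ≤ lpError x p V I + ε * ∑ i, ‖x i‖ ^ p

end SubspaceOutliers

end

/-!
The residual of `V` with respect to the span `H` of the sample is the sum of the squared sines of
the principal angles between `V` and `H`; it is at most `dim V` and decreases as the sample grows.
The candidate approximation inside `H` is the orthogonal projection of `V` to `H`. Replacing `V` by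
this projection raises the distance to a point `y` by at most `‖y‖ √δ`, where `δ` is the amount by
which the residual drops when `y` joins the sample. So if the projection is bad, with an error that
is too large by more than `ε ∑ i, ‖x i‖ ^ p`, then by convexity of `t ↦ t ^ p` and Jensen's
inequality one draw with weights `‖x i‖ ^ p` lowers the residual by at least `(ε / p) ^ 2` on
average. As the residual stays nonnegative, `N` such draws all leave a bad projection with
probability at most `k (p / ε) ^ 2 / N`.

The first round therefore already yields the approximating subspace. The later rounds only enlarge
the span, and each of them raises its dimension until it contains all the points, so after `k`
rounds there is room to enlarge the subspace to the required dimension, which does not increase the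
error.
-/

open Metric Module
open scoped ENNReal InnerProductSpace

noncomputable section

namespace SubspaceOutliers

section Geometry

variable {𝕜 E : Type*} [RCLike 𝕜] [NormedAddCommGroup E] [InnerProductSpace 𝕜 E]

lemma infDist_le_norm (y : E) (H : Submodule 𝕜 E) : infDist y H ≤ ‖y‖ := by
  simpa only [dist_zero_right] using infDist_le_dist_of_mem (x := y) H.zero_mem

lemma infDist_le_norm_sub {y w : E} {H : Submodule 𝕜 E} (hw : w ∈ H) :
    infDist y H ≤ ‖y - w‖ := by
  simpa only [dist_eq_norm] using infDist_le_dist_of_mem (x := y) hw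

lemma infDist_eq_norm_sub_starProjection (y : E) (H : Submodule 𝕜 E) [H.HasOrthogonalProjection] :
    infDist y H = ‖y - H.starProjection y‖ := by
  simp only [H.starProjection_minimal, infDist_eq_iInf, dist_eq_norm]
  rfl

lemma infDist_sq_eq_add_norm_sq {H H' : Submodule 𝕜 E} [H.HasOrthogonalProjection]
    [H'.HasOrthogonalProjection] (hH : H ≤ H') (u : E) :
    infDist u H ^ 2 = infDist u H' ^ 2 + ‖H'.starProjection u - H.starProjection u‖ ^ 2 := by
  have hmem : H'.starProjection u - H.starProjection u ∈ H' :=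
    H'.sub_mem (H'.starProjection_apply_mem u) (hH (H.starProjection_apply_mem u))
  have hpyth := norm_add_sq_eq_norm_sq_add_norm_sq_of_inner_eq_zero _ _
    (Submodule.inner_left_of_mem_orthogonal hmem (H'.sub_starProjection_mem_orthogonal u))
  rw [sub_add_sub_cancel] at hpyth
  simpa only [infDist_eq_norm_sub_starProjection, sq] using hpyth

lemma norm_inner_sq_le_infDist_sq_sub {H H' : Submodule 𝕜 E} [H.HasOrthogonalProjection]
    [H'.HasOrthogonalProjection] (hH : H ≤ H') {z : E} (hz : z ∈ H') (hzH : z ∈ Hᗮ) (u : E) :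
    ‖⟪u, z⟫_𝕜‖ ^ 2 ≤ (infDist u H ^ 2 - infDist u H' ^ 2) * ‖z‖ ^ 2 := by
  have hinner : ⟪u, z⟫_𝕜 = ⟪H'.starProjection u - H.starProjection u, z⟫_𝕜 := by
    rw [inner_sub_left, H'.inner_starProjection_left_eq_right,
      Submodule.starProjection_eq_self_iff.mpr hz,
      Submodule.inner_right_of_mem_orthogonal (H.starProjection_apply_mem u) hzH, sub_zero]
  rw [infDist_sq_eq_add_norm_sq hH, add_sub_cancel_left, hinner, ← mul_pow]
  gcongr
  exact norm_inner_le_norm _ _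

/-- The sum of the squared sines of the principal angles between `V` and `H`, which measures how
far `H` is from containing `V`. It is computed here in one orthonormal basis of `V`, but does not
depend on that choice. -/
def residual (V H : Submodule 𝕜 E) [FiniteDimensional 𝕜 V] : ℝ :=
  ∑ j, infDist (stdOrthonormalBasis 𝕜 V j : E) H ^ 2

lemma residual_nonneg (V H : Submodule 𝕜 E) [FiniteDimensional 𝕜 V] : 0 ≤ residual V H :=
  Finset.sum_nonneg fun _ _ => sq_nonneg _

lemma residual_anti (V : Submodule 𝕜 E) [FiniteDimensional 𝕜 V] {H H' : Submodule 𝕜 E}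
    (hH : H ≤ H') : residual V H' ≤ residual V H :=
  Finset.sum_le_sum fun _ _ =>
    pow_le_pow_left₀ infDist_nonneg (infDist_le_infDist_of_subset hH H.nonempty) 2

lemma residual_le_finrank (V H : Submodule 𝕜 E) [FiniteDimensional 𝕜 V] :
    residual V H ≤ finrank 𝕜 V := by
  have hbasis (j) : infDist (stdOrthonormalBasis 𝕜 V j : E) H ^ 2 ≤ 1 :=
    pow_le_one₀ infDist_nonneg
      ((infDist_le_norm _ H).trans_eq ((stdOrthonormalBasis 𝕜 V).norm_eq_one j))
  simpa [residual] using Finset.sum_le_sum fun j (_ : j ∈ Finset.univ) => hbasis j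

lemma sum_norm_inner_stdOrthonormalBasis_sq (V : Submodule 𝕜 E) [FiniteDimensional 𝕜 V] (z : E) :
    ∑ j, ‖⟪(stdOrthonormalBasis 𝕜 V j : E), z⟫_𝕜‖ ^ 2 = ‖V.starProjection z‖ ^ 2 := by
  have hparseval := (stdOrthonormalBasis 𝕜 V).sum_sq_norm_inner_right (V.orthogonalProjectionOnto z)
  simpa only [Submodule.inner_orthogonalProjectionOnto_eq_of_mem_left, Submodule.coe_norm,
    ← Submodule.starProjection_apply] using hparseval

lemma norm_starProjection_sq_le_residual_sub (V : Submodule 𝕜 E) [FiniteDimensional 𝕜 V]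
    {H H' : Submodule 𝕜 E} [H.HasOrthogonalProjection] [H'.HasOrthogonalProjection] (hH : H ≤ H')
    {z : E} (hz : z ∈ H') (hzH : z ∈ Hᗮ) :
    ‖V.starProjection z‖ ^ 2 ≤ (residual V H - residual V H') * ‖z‖ ^ 2 := by
  rw [residual, residual, ← Finset.sum_sub_distrib, Finset.sum_mul,
    ← sum_norm_inner_stdOrthonormalBasis_sq]
  exact Finset.sum_le_sum fun j _ => norm_inner_sq_le_infDist_sq_sub hH hz hzH _

lemma norm_sub_starProjection_mul_le_re_inner (H : Submodule 𝕜 E) [H.HasOrthogonalProjection]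
    (y v : E) :
    ‖y - H.starProjection v‖ * (‖y - H.starProjection v‖ - ‖y - v‖) ≤
      RCLike.re ⟪y - H.starProjection y, v⟫_𝕜 := by
  set w := y - H.starProjection v
  have hinner : ⟪y - H.starProjection y, v⟫_𝕜 = ⟪w, w⟫_𝕜 - ⟪w, y - v⟫_𝕜 := by
    have hself : ⟪H.starProjection v, H.starProjection v⟫_𝕜 = ⟪H.starProjection v, v⟫_𝕜 := by
      rw [← H.inner_starProjection_left_eq_right,
        Submodule.starProjection_eq_self_iff.mpr (H.starProjection_apply_mem v)]
    simp only [w, inner_sub_left, inner_sub_right, hself, H.inner_starProjection_left_eq_right y v]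
    ring
  rw [hinner, map_sub, inner_self_eq_norm_sq]
  linarith [re_inner_le_norm (𝕜 := 𝕜) w (y - v)]

lemma infDist_map_starProjection_le (V : Submodule 𝕜 E) [FiniteDimensional 𝕜 V]
    {H H' : Submodule 𝕜 E} [H.HasOrthogonalProjection] [H'.HasOrthogonalProjection] (hH : H ≤ H')
    {y : E} (hy : y ∈ H') :
    infDist y (V.map H.starProjection.toLinearMap) ≤
      infDist y V + ‖y‖ * √(residual V H - residual V H') := by
  set v := V.starProjection y
  set z := y - H.starProjection y
  set D := ‖y - H.starProjection v‖
  have hvV : v ∈ V := V.starProjection_apply_mem y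
  have hz : z ∈ H' := H'.sub_mem hy (hH (H.starProjection_apply_mem y))
  have hzD : ‖z‖ ≤ D := by
    rw [← infDist_eq_norm_sub_starProjection]
    exact infDist_le_norm_sub (H.starProjection_apply_mem v)
  have hproj : ‖V.starProjection z‖ ≤ √(residual V H - residual V H') * ‖z‖ := by
    rw [← Real.sqrt_sq (norm_nonneg z), ← Real.sqrt_mul' _ (sq_nonneg _)]
    exact Real.le_sqrt_of_sq_le (norm_starProjection_sq_le_residual_sub V hH hz
      (H.sub_starProjection_mem_orthogonal y))
  -- The loss `D - ‖y - v‖` is governed by the part of the fresh direction `z` lying along `V`, and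
  -- this is what the residual loses when `z` is adjoined to `H`.
  have hmul : D * (D - ‖y - v‖) ≤ D * (‖y‖ * √(residual V H - residual V H')) :=
    calc D * (D - ‖y - v‖)
        ≤ RCLike.re ⟪z, v⟫_𝕜 := norm_sub_starProjection_mul_le_re_inner H y v
      _ = RCLike.re ⟪V.starProjection z, y⟫_𝕜 := by rw [V.inner_starProjection_left_eq_right]
      _ ≤ ‖V.starProjection z‖ * ‖y‖ := re_inner_le_norm _ _
      _ ≤ (√(residual V H - residual V H') * D) * ‖y‖ := by grw [hproj, hzD]
      _ = D * (‖y‖ * √(residual V H - residual V H')) := by ring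
  have hgap : D ≤ ‖y - v‖ + ‖y‖ * √(residual V H - residual V H') := by
    have hD₀ : 0 ≤ D := norm_nonneg _
    rcases hD₀.eq_or_lt with hD | hD
    · rw [← hD]
      positivity
    · linarith [le_of_mul_le_mul_left hmul hD]
  rw [infDist_eq_norm_sub_starProjection y V]
  exact (infDist_le_norm_sub (Submodule.mem_map_of_mem hvV)).trans hgap

end Geometry

lemma exists_finrank_eq_of_le {K M : Type*} [DivisionRing K] [AddCommGroup M] [Module K M]
    [Module.Finite K M] {W U : Submodule K M} (hWU : W ≤ U) {m : ℕ} (hWm : finrank K W ≤ m)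
    (hmU : m ≤ finrank K U) : ∃ W' : Submodule K M, W ≤ W' ∧ W' ≤ U ∧ finrank K W' = m := by
  induction m, hWm using Nat.le_induction with
  | base => exact ⟨W, le_rfl, hWU, rfl⟩
  | succ m _ ih =>
    obtain ⟨W', hWW', hW'U, rfl⟩ := ih (Nat.le_of_succ_le hmU)
    obtain ⟨u, huU, huW'⟩ : ∃ u ∈ U, u ∉ W' :=
      SetLike.not_le_iff_exists.mp fun hUW' => hmU.not_gt
        (Nat.lt_succ_of_le (Submodule.finrank_mono hUW'))
    exact ⟨W' ⊔ K ∙ u, hWW'.trans le_sup_left,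
      sup_le hW'U ((Submodule.span_singleton_le_iff_mem u U).mpr huU),
      Submodule.finrank_sup_span_singleton huW'⟩

lemma rpow_add_mul_sub_le_rpow {a b p : ℝ} (ha : 0 < a) (hb : 0 ≤ b) (hp : 1 ≤ p) :
    a ^ p + p * a ^ (p - 1) * (b - a) ≤ b ^ p := by
  have hbernoulli : 1 + p * (b / a - 1) ≤ (b / a) ^ p := by
    simpa using one_add_mul_self_le_rpow_one_add (s := b / a - 1)
      (by linarith [div_nonneg hb ha.le]) hp
  calc a ^ p + p * a ^ (p - 1) * (b - a)
      = a ^ p * (1 + p * (b / a - 1)) := by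
        rw [Real.rpow_sub_one ha.ne']
        field_simp
    _ ≤ a ^ p * (b / a) ^ p := by gcongr
    _ = b ^ p := by rw [← Real.mul_rpow ha.le (by positivity), mul_div_cancel₀ _ ha.ne']

lemma rpow_le_rpow_add_mul {a b c s p : ℝ} (ha : 0 ≤ a) (hac : a ≤ c) (hb : 0 ≤ b) (hs : 0 ≤ s)
    (hp : 1 ≤ p) (h : a ≤ b + c * s) : a ^ p ≤ b ^ p + p * (c ^ p * s) := by
  have hc : 0 ≤ c := ha.trans hac
  rcases le_or_gt a b with hab | hba
  · calc a ^ p ≤ b ^ p := by gcongr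
      _ ≤ b ^ p + p * (c ^ p * s) := by linarith [show 0 ≤ p * (c ^ p * s) by positivity]
  · have ha' : 0 < a := hb.trans_lt hba
    have hc' : 0 < c := ha'.trans_le hac
    have hslope : p * a ^ (p - 1) * (a - b) ≤ p * (c ^ p * s) :=
      calc p * a ^ (p - 1) * (a - b)
          ≤ p * c ^ (p - 1) * (c * s) := by
            gcongr
            linarith
        _ = p * (c ^ p * s) := by
            rw [Real.rpow_sub_one hc'.ne']
            field_simp
    linarith [rpow_add_mul_sub_le_rpow ha' hb hp]

section MonotoneProcess

variable {α : Type*}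

lemma toOuterMeasure_add_toOuterMeasure_compl (μ : PMF α) (B : Set α) :
    μ.toOuterMeasure B + μ.toOuterMeasure Bᶜ = 1 := by
  rw [PMF.toOuterMeasure_apply, PMF.toOuterMeasure_apply, ← ENNReal.tsum_add, ← μ.tsum_coe]
  exact tsum_congr fun a => congrFun (Set.indicator_self_add_compl B μ) a

lemma toOuterMeasure_le_one (μ : PMF α) (B : Set α) : μ.toOuterMeasure B ≤ 1 :=
  le_self_add.trans_eq (toOuterMeasure_add_toOuterMeasure_compl μ B)

lemma toOuterMeasure_eq_zero_of_isLowerSet [Preorder α] {μ : PMF α} {a : α} {B : Set α}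
    (hμ : ∀ b ∈ μ.support, a ≤ b) (hB : IsLowerSet B) (ha : a ∉ B) : μ.toOuterMeasure B = 0 := by
  rw [PMF.toOuterMeasure_apply_eq_zero_iff, Set.disjoint_left]
  exact fun b hb hbB => ha (hB (hμ b hb) hbB)

lemma toOuterMeasure_bind_le_of_isLowerSet [Preorder α] (μ : PMF α) {κ : α → PMF α}
    (hκ : ∀ a, ∀ b ∈ (κ a).support, a ≤ b) {B : Set α} (hB : IsLowerSet B) :
    (μ.bind κ).toOuterMeasure B ≤ μ.toOuterMeasure B := by
  rw [PMF.toOuterMeasure_bind_apply, PMF.toOuterMeasure_apply]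
  refine ENNReal.tsum_le_tsum fun a => ?_
  by_cases ha : a ∈ B
  · rw [Set.indicator_of_mem ha]
    exact mul_le_of_le_one_right' (toOuterMeasure_le_one _ _)
  · rw [toOuterMeasure_eq_zero_of_isLowerSet (hκ a) hB ha, mul_zero]
    exact zero_le

lemma subset_of_mem_support_map_union {ι : Type*} [DecidableEq ι] {μ : PMF α} {g : α → Finset ι}
    {S T : Finset ι} (hT : T ∈ (μ.map fun a => S ∪ g a).support) : S ⊆ T := by
  obtain ⟨a, _, rfl⟩ := (PMF.mem_support_map_iff _ _ _).mp hT
  exact Finset.subset_union_left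

end MonotoneProcess

section IndependentDraws

variable {ι : Type} [Fintype ι] (q : PMF ι)

lemma iid_apply {N : ℕ} (f : Fin N → ι) : iid q N f = ∏ j, q (f j) := rfl

lemma mem_support_of_mem_support_iid {q : PMF ι} {N : ℕ} {f : Fin N → ι}
    (hf : f ∈ (iid q N).support) (j : Fin N) : f j ∈ q.support := by
  rw [PMF.mem_support_iff, iid_apply, Finset.prod_ne_zero_iff] at hf
  exact (PMF.mem_support_iff _ _).mpr (hf j (Finset.mem_univ j))

lemma iid_succ (N : ℕ) : iid q (N + 1) = q.bind fun i => (iid q N).map (Fin.cons i) := by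
  classical
  ext f
  obtain ⟨i, g, rfl⟩ : ∃ i g, f = Fin.cons i g := ⟨f 0, Fin.tail f, (Fin.cons_self_tail f).symm⟩
  have hcons (j : ι) : (iid q N).map (Fin.cons j) (Fin.cons i g : Fin (N + 1) → ι) =
      if i = j then iid q N g else 0 := by
    simp only [PMF.map_apply, Fin.cons_inj, ite_and, tsum_fintype]
    split_ifs <;> simp
  simp only [PMF.bind_apply, hcons, tsum_fintype, mul_ite, mul_zero, Finset.sum_ite_eq,
    Finset.mem_univ, if_true, iid_apply, Fin.prod_univ_succ, Fin.cons_zero, Fin.cons_succ]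

variable [DecidableEq ι]

lemma map_union_image_iid_succ (N : ℕ) (S : Finset ι) :
    ((iid q (N + 1)).map fun f => S ∪ Finset.univ.image f) =
      q.bind fun i => (iid q N).map fun f => insert i S ∪ Finset.univ.image f := by
  rw [iid_succ, PMF.map_bind]
  congr 1 with i : 1
  rw [PMF.map_comp]
  congr 1 with f a
  simp [Fin.exists_fin_succ, eq_comm, or_left_comm]

-- Each draw made inside `B` costs `c` of the potential on average, and a sample that ends in the
-- lower set `B` has been inside `B` at every draw.
lemma natCast_mul_toOuterMeasure_map_union_image_iid_le {Φ : Finset ι → ℝ≥0∞}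
    {B : Set (Finset ι)} {c : ℝ≥0∞} (hB : IsLowerSet B)
    (hΦ : ∀ S ∈ B, c + ∑ i, q i * Φ (insert i S) ≤ Φ S) (N : ℕ) (S : Finset ι) :
    N * c * ((iid q N).map fun f => S ∪ Finset.univ.image f).toOuterMeasure B ≤ Φ S := by
  induction N generalizing S with
  | zero => simp
  | succ N ih =>
    by_cases hS : S ∈ B
    swap
    · rw [toOuterMeasure_eq_zero_of_isLowerSet (fun T => subset_of_mem_support_map_union) hB hS,
        mul_zero]
      exact zero_le
    set P : Finset ι → ℝ≥0∞ := fun T =>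
      ((iid q N).map fun f => T ∪ Finset.univ.image f).toOuterMeasure B
    have hP : ((iid q (N + 1)).map fun f => S ∪ Finset.univ.image f).toOuterMeasure B =
        ∑ i, q i * P (insert i S) := by
      rw [map_union_image_iid_succ, PMF.toOuterMeasure_bind_apply, tsum_fintype]
    calc ((N + 1 : ℕ) : ℝ≥0∞) * c *
          ((iid q (N + 1)).map fun f => S ∪ Finset.univ.image f).toOuterMeasure B
        = c * ((iid q (N + 1)).map fun f => S ∪ Finset.univ.image f).toOuterMeasure B +
            ∑ i, q i * (N * c * P (insert i S)) := by
          simp only [mul_left_comm (q _), ← Finset.mul_sum, ← hP]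
          push_cast
          ring
      _ ≤ c * 1 + ∑ i, q i * Φ (insert i S) := by
          gcongr with i
          · exact toOuterMeasure_le_one _ _
          · exact ih _
      _ ≤ Φ S := by
          rw [mul_one]
          exact hΦ S hS

end IndependentDraws

section Sample

variable {n d : ℕ} {x : Fin n → Pt d} {k N : ℕ} {p ε : ℝ} {V : Submodule ℝ (Pt d)}
  {I S S' : Finset (Fin n)}

lemma spanOf_mono (x : Fin n → Pt d) (h : S ⊆ S') : spanOf x S ≤ spanOf x S' :=
  Submodule.span_mono (Set.image_mono (Finset.coe_subset.mpr h))

lemma mem_spanOf {i : Fin n} (h : i ∈ S) : x i ∈ spanOf x S :=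
  Submodule.subset_span (Set.mem_image_of_mem x h)

lemma spanOf_le_span_range (x : Fin n → Pt d) (S : Finset (Fin n)) :
    spanOf x S ≤ Submodule.span ℝ (Set.range x) :=
  Submodule.span_mono (Set.image_subset_range x S)

lemma spanOf_empty (x : Fin n → Pt d) : spanOf x ∅ = ⊥ := by
  simp [spanOf]

lemma distTo_bot (y : Pt d) : distTo y ⊥ = ‖y‖ := by
  simp [distTo]

lemma distTo_nonneg (y : Pt d) (V : Submodule ℝ (Pt d)) : 0 ≤ distTo y V :=
  infDist_nonneg

lemma distTo_eq_zero_iff {y : Pt d} : distTo y V = 0 ↔ y ∈ V :=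
  (V.closed_of_finiteDimensional.mem_iff_infDist_zero V.nonempty).symm

lemma lpError_anti (x : Fin n → Pt d) (hp : 0 ≤ p) {W : Submodule ℝ (Pt d)} (h : V ≤ W)
    (I : Finset (Fin n)) : lpError x p W I ≤ lpError x p V I :=
  Finset.sum_le_sum fun _ _ => Real.rpow_le_rpow (distTo_nonneg _ _)
    (infDist_le_infDist_of_subset h V.nonempty) hp

lemma lpError_bot_le (x : Fin n → Pt d) (p : ℝ) (I : Finset (Fin n)) :
    lpError x p ⊥ I ≤ ∑ i, ‖x i‖ ^ p := by
  simp only [lpError, distTo_bot]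
  exact Finset.sum_le_univ_sum_of_nonneg fun i => Real.rpow_nonneg (norm_nonneg (x i)) p

lemma lpError_nonneg (x : Fin n → Pt d) (p : ℝ) (V : Submodule ℝ (Pt d)) (I : Finset (Fin n)) :
    0 ≤ lpError x p V I :=
  Finset.sum_nonneg fun _ _ => Real.rpow_nonneg (distTo_nonneg _ _) p

lemma lpError_map_starProjection_le (hp : 1 ≤ p) (x : Fin n → Pt d) (V : Submodule ℝ (Pt d))
    (I S : Finset (Fin n)) :
    lpError x p (V.map (spanOf x S).starProjection.toLinearMap) I ≤ lpError x p V I +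
      p * ∑ i, ‖x i‖ ^ p * √(residual V (spanOf x S) - residual V (spanOf x (insert i S))) := by
  set loss : Fin n → ℝ := fun i =>
    ‖x i‖ ^ p * √(residual V (spanOf x S) - residual V (spanOf x (insert i S)))
  have hpoint (i : Fin n) : distTo (x i) (V.map (spanOf x S).starProjection.toLinearMap) ^ p ≤
      distTo (x i) V ^ p + p * loss i :=
    rpow_le_rpow_add_mul (distTo_nonneg _ _) (infDist_le_norm _ _) (distTo_nonneg _ _)
      (Real.sqrt_nonneg _) hp (infDist_map_starProjection_le V
        (spanOf_mono x (Finset.subset_insert i S)) (mem_spanOf (Finset.mem_insert_self i S)))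
  calc lpError x p (V.map (spanOf x S).starProjection.toLinearMap) I
      ≤ ∑ i ∈ I, (distTo (x i) V ^ p + p * loss i) := Finset.sum_le_sum fun i _ => hpoint i
    _ = lpError x p V I + p * ∑ i ∈ I, loss i := by
        rw [Finset.sum_add_distrib, Finset.mul_sum, lpError]
    _ ≤ lpError x p V I + p * ∑ i, loss i := by
        gcongr
        exact Finset.subset_univ I

/-- The sampled set `S` nearly captures `V` on `I`: its span contains a subspace of dimension at
most `k` whose error over `I` exceeds that of `V` by at most `ε ∑ i, ‖x i‖ ^ p`. In contrast to
`IsGood` the dimension is only bounded, so that the property can hold after a single round. -/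
def Approximates (x : Fin n → Pt d) (k : ℕ) (p ε : ℝ) (V : Submodule ℝ (Pt d))
    (I S : Finset (Fin n)) : Prop :=
  ∃ W : Submodule ℝ (Pt d), W ≤ spanOf x S ∧ finrank ℝ W ≤ k ∧
    lpError x p W I ≤ lpError x p V I + ε * ∑ i, ‖x i‖ ^ p

lemma isLowerSet_setOf_not_approximates (x : Fin n → Pt d) (k : ℕ) (p ε : ℝ)
    (V : Submodule ℝ (Pt d)) (I : Finset (Fin n)) :
    IsLowerSet {S | ¬Approximates x k p ε V I S} :=
  fun _ _ hS => mt fun ⟨W, hW, hrank, herr⟩ => ⟨W, hW.trans (spanOf_mono x hS), hrank, herr⟩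

lemma Approximates.isGood (hS : Approximates x k p ε V I S) (hp : 0 ≤ p)
    (hrank : min k (finrank ℝ (Submodule.span ℝ (Set.range x))) ≤ finrank ℝ (spanOf x S)) :
    IsGood x k p ε V I S := by
  obtain ⟨W, hWS, hWk, herr⟩ := hS
  have hW : finrank ℝ W ≤ min k (finrank ℝ (Submodule.span ℝ (Set.range x))) :=
    le_min hWk (Submodule.finrank_mono (hWS.trans (spanOf_le_span_range x S)))
  obtain ⟨W', hWW', hW'S, hW'⟩ := exists_finrank_eq_of_le hWS hW hrank
  exact ⟨W', hW'S, hW', (lpError_anti x hp hWW' I).trans herr⟩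

lemma approximates_of_sum_eq_zero (hx : ∑ i, ‖x i‖ ^ p = 0) : Approximates x k p ε V I S := by
  refine ⟨⊥, bot_le, by simp, (lpError_bot_le x p I).trans ?_⟩
  rw [hx, mul_zero, add_zero]
  exact lpError_nonneg x p V I

lemma sq_add_sum_mul_residual_le_of_not_approximates (hp : 1 ≤ p) (hε : 0 < ε)
    (hV : finrank ℝ V ≤ k) (hS : ¬Approximates x k p ε V I S) :
    (ε / p) ^ 2 + ∑ i, ‖x i‖ ^ p / (∑ j, ‖x j‖ ^ p) * residual V (spanOf x (insert i S)) ≤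
      residual V (spanOf x S) := by
  set T := ∑ j, ‖x j‖ ^ p
  set drop : Fin n → ℝ := fun i => residual V (spanOf x S) - residual V (spanOf x (insert i S))
  have hT : 0 < T := (show 0 ≤ T by positivity).lt_of_ne' (mt approximates_of_sum_eq_zero hS)
  have hw (i : Fin n) : 0 ≤ ‖x i‖ ^ p / T := by positivity
  have hsum : ∑ i, ‖x i‖ ^ p / T = 1 := by rw [← Finset.sum_div, div_self hT.ne']
  have hdrop (i : Fin n) : 0 ≤ drop i :=
    sub_nonneg.mpr (residual_anti V (spanOf_mono x (Finset.subset_insert i S)))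
  have hfail : lpError x p V I + ε * T <
      lpError x p (V.map (spanOf x S).starProjection.toLinearMap) I :=
    not_le.mp fun herr => hS ⟨_, Submodule.map_le_iff_le_comap.mpr fun v _ =>
      (spanOf x S).starProjection_apply_mem v, (Submodule.finrank_map_le _ V).trans hV, herr⟩
  have hmean : ε / p ≤ ∑ i, ‖x i‖ ^ p / T * √(drop i) := by
    have hloss : ε * T ≤ p * ∑ i, ‖x i‖ ^ p * √(drop i) := by
      linarith [lpError_map_starProjection_le hp x V I S]
    simp only [div_mul_eq_mul_div, ← Finset.sum_div]
    rwa [div_le_div_iff₀ (by linarith) hT, mul_comm _ p]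
  have hjensen : (ε / p) ^ 2 ≤ ∑ i, ‖x i‖ ^ p / T * drop i :=
    calc (ε / p) ^ 2 ≤ (∑ i, ‖x i‖ ^ p / T * √(drop i)) ^ 2 := by gcongr
      _ ≤ ∑ i, ‖x i‖ ^ p / T * √(drop i) ^ 2 :=
        Real.pow_arith_mean_le_arith_mean_pow _ _ _ (fun i _ => hw i) hsum
          (fun _ _ => Real.sqrt_nonneg _) 2
      _ = ∑ i, ‖x i‖ ^ p / T * drop i := by simp only [Real.sq_sqrt (hdrop _)]
  simp only [drop, mul_sub, Finset.sum_sub_distrib, ← Finset.sum_mul, hsum, one_mul] at hjensen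
  linarith

lemma weight_eq_zero_iff (hp : 0 < p) {i : Fin n} : weight x p S i = 0 ↔ x i ∈ spanOf x S := by
  rw [weight, ENNReal.ofReal_eq_zero, (Real.rpow_nonneg (distTo_nonneg _ _) p).ge_iff_eq',
    Real.rpow_eq_zero (distTo_nonneg _ _) hp.ne', distTo_eq_zero_iff]

lemma weight_empty (x : Fin n → Pt d) (p : ℝ) (i : Fin n) :
    weight x p ∅ i = ENNReal.ofReal (‖x i‖ ^ p) := by
  rw [weight, spanOf_empty, distTo_bot]

lemma subset_of_mem_support_round (h : S' ∈ (round x p N S).support) : S ⊆ S' := by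
  classical
  rw [round] at h
  split_ifs at h with hw
  · exact ((PMF.mem_support_pure_iff _ _).mp h).ge
  · exact subset_of_mem_support_map_union h

lemma tsum_weight_empty (x : Fin n → Pt d) (p : ℝ) :
    ∑' i, weight x p ∅ i = ENNReal.ofReal (∑ i, ‖x i‖ ^ p) := by
  simp only [weight_empty, tsum_fintype]
  exact (ENNReal.ofReal_sum_of_nonneg fun _ _ => by positivity).symm

lemma normalize_weight_empty_apply (h : ∑' i, weight x p ∅ i ≠ 0) (i : Fin n) :
    PMF.normalize (weight x p ∅) h (tsum_weight_ne_top x p ∅) i =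
      ENNReal.ofReal (‖x i‖ ^ p / ∑ j, ‖x j‖ ^ p) := by
  have hT : 0 < ∑ j, ‖x j‖ ^ p := by
    rwa [tsum_weight_empty, ne_eq, ENNReal.ofReal_eq_zero, not_le] at h
  rw [PMF.normalize_apply, tsum_weight_empty, weight_empty, ENNReal.ofReal_div_of_pos hT,
    div_eq_mul_inv]

lemma natCast_mul_toOuterMeasure_round_empty_le (hp : 1 ≤ p) (hε : 0 < ε)
    (hV : finrank ℝ V ≤ k) (x : Fin n → Pt d) (N : ℕ) (I : Finset (Fin n)) :
    N * ENNReal.ofReal ((ε / p) ^ 2) *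
      (round x p N ∅).toOuterMeasure {S | ¬Approximates x k p ε V I S} ≤ k := by
  classical
  by_cases hw : ∑' i, weight x p ∅ i = 0
  · have hx : ∑ i, ‖x i‖ ^ p = 0 := by
      rw [tsum_weight_empty, ENNReal.ofReal_eq_zero] at hw
      exact hw.antisymm (by positivity)
    simp [approximates_of_sum_eq_zero hx]
  have hdrift : ∀ S ∈ {S | ¬Approximates x k p ε V I S}, ENNReal.ofReal ((ε / p) ^ 2) +
      ∑ i, PMF.normalize (weight x p ∅) hw (tsum_weight_ne_top x p ∅) i *
        ENNReal.ofReal (residual V (spanOf x (insert i S))) ≤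
      ENNReal.ofReal (residual V (spanOf x S)) := fun S hS => by
    have hterm (i : Fin n) :
        0 ≤ ‖x i‖ ^ p / (∑ j, ‖x j‖ ^ p) * residual V (spanOf x (insert i S)) :=
      mul_nonneg (by positivity) (residual_nonneg _ _)
    refine le_of_eq_of_le ?_ (ENNReal.ofReal_le_ofReal
      (sq_add_sum_mul_residual_le_of_not_approximates hp hε hV hS))
    rw [ENNReal.ofReal_add (sq_nonneg _) (Finset.sum_nonneg fun i _ => hterm i),
      ENNReal.ofReal_sum_of_nonneg fun i _ => hterm i]
    simp only [normalize_weight_empty_apply, ENNReal.ofReal_mul' (residual_nonneg _ _)]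
  have hbound : residual V (spanOf x ∅) ≤ k :=
    (residual_le_finrank V _).trans (Nat.cast_le.mpr hV)
  rw [round, dif_neg hw]
  calc _ ≤ ENNReal.ofReal (residual V (spanOf x ∅)) :=
        natCast_mul_toOuterMeasure_map_union_image_iid_le _
          (isLowerSet_setOf_not_approximates x k p ε V I) hdrift N ∅
    _ ≤ k := (ENNReal.ofReal_le_ofReal hbound).trans_eq (ENNReal.ofReal_natCast k)

lemma toOuterMeasure_round_empty_le (hp : 1 ≤ p) (hε : 0 < ε) (hV : finrank ℝ V ≤ k) (hN : 0 < N)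
    (x : Fin n → Pt d) (I : Finset (Fin n)) :
    (round x p N ∅).toOuterMeasure {S | ¬Approximates x k p ε V I S} ≤
      ENNReal.ofReal (k * (p / ε) ^ 2 / N) := by
  have hN' : (0 : ℝ) < N := by exact_mod_cast hN
  have hc : 0 < N * (ε / p) ^ 2 := by positivity
  have hk : (k * (p / ε) ^ 2 / N : ℝ) = k / (N * (ε / p) ^ 2) := by field_simp
  rw [hk, ENNReal.ofReal_div_of_pos hc, ENNReal.ofReal_natCast,
    ENNReal.le_div_iff_mul_le (Or.inl (ENNReal.ofReal_pos.mpr hc).ne')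
      (Or.inl ENNReal.ofReal_ne_top), mul_comm,
    ENNReal.ofReal_mul hN'.le, ENNReal.ofReal_natCast]
  exact natCast_mul_toOuterMeasure_round_empty_le hp hε hV x N I

lemma toOuterMeasure_adaptiveSample_le_round_empty (x : Fin n → Pt d) (p : ℝ) (N : ℕ)
    {B : Set (Finset (Fin n))} (hB : IsLowerSet B) {t : ℕ} (ht : 1 ≤ t) :
    (adaptiveSample x p N t).toOuterMeasure B ≤ (round x p N ∅).toOuterMeasure B := by
  induction t, ht using Nat.le_induction with
  | base => simp only [adaptiveSample, PMF.pure_bind, le_rfl]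
  | succ t _ ih =>
    exact (toOuterMeasure_bind_le_of_isLowerSet _ (fun _ _ => subset_of_mem_support_round)
      hB).trans ih

lemma min_le_finrank_of_mem_support_round (hp : 0 < p) (hN : 0 < N)
    (h : S' ∈ (round x p N S).support) :
    min (finrank ℝ (spanOf x S) + 1) (finrank ℝ (Submodule.span ℝ (Set.range x))) ≤
      finrank ℝ (spanOf x S') := by
  classical
  rw [round] at h
  split_ifs at h with hw
  · obtain rfl := (PMF.mem_support_pure_iff _ _).mp h
    refine (min_le_right _ _).trans (Submodule.finrank_mono (Submodule.span_le.mpr ?_))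
    rintro _ ⟨i, rfl⟩
    exact (weight_eq_zero_iff hp).mp (ENNReal.tsum_eq_zero.mp hw i)
  · obtain ⟨f, hf, rfl⟩ := (PMF.mem_support_map_iff _ _ _).mp h
    set i := f ⟨0, hN⟩
    have hi : x i ∉ spanOf x S := mt (weight_eq_zero_iff hp).mpr
      ((PMF.mem_support_normalize_iff _ _ i).mp (mem_support_of_mem_support_iid hf _))
    have hi' : x i ∈ spanOf x (S ∪ Finset.univ.image f) := mem_spanOf
      (Finset.mem_union_right _ (Finset.mem_image_of_mem f (Finset.mem_univ _)))
    exact (min_le_left _ _).trans (Submodule.finrank_lt_finrank_of_lt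
      (SetLike.lt_iff_le_and_exists.mpr ⟨spanOf_mono x Finset.subset_union_left, x i, hi', hi⟩))

lemma min_le_finrank_of_mem_support_adaptiveSample (hp : 0 < p) (hN : 0 < N) (t : ℕ)
    (h : S ∈ (adaptiveSample x p N t).support) :
    min t (finrank ℝ (Submodule.span ℝ (Set.range x))) ≤ finrank ℝ (spanOf x S) := by
  induction t generalizing S with
  | zero => simp
  | succ t ih =>
    obtain ⟨S₀, hS₀, hS⟩ := (PMF.mem_support_bind_iff _ _ _).mp h
    have hrank₀ := ih hS₀
    have hrank := min_le_finrank_of_mem_support_round hp hN hS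
    omega

lemma one_le_toOuterMeasure_not_approximates_add (hp : 0 < p) (hN : 0 < N)
    (x : Fin n → Pt d) (k : ℕ) (ε : ℝ) (V : Submodule ℝ (Pt d)) (I : Finset (Fin n)) :
    1 ≤ (adaptiveSample x p N k).toOuterMeasure {S | ¬Approximates x k p ε V I S} +
      (adaptiveSample x p N k).toOuterMeasure {S | IsGood x k p ε V I S} := by
  rw [← toOuterMeasure_add_toOuterMeasure_compl _ {S | ¬Approximates x k p ε V I S}]
  refine add_le_add_right (PMF.toOuterMeasure_mono _ fun S hS => ?_) _
  exact (not_not.mp hS.1).isGood hp.le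
    (min_le_finrank_of_mem_support_adaptiveSample hp hN k hS.2)

end Sample

section RoundSize

variable {C p ε : ℝ} {k : ℕ}

lemma half_le_log_two_mul_div (hk : 1 ≤ k) (hε : 0 < ε) (hε1 : ε < 1) :
    1 / 2 ≤ Real.log (2 * k / ε) := by
  have hk' : (1 : ℝ) ≤ k := by exact_mod_cast hk
  have htwo : (2 : ℝ) ≤ 2 * k / ε := by
    rw [le_div_iff₀ hε]
    nlinarith
  linarith [Real.log_le_log two_pos htwo, Real.log_two_gt_d9]

lemma mul_div_sq_le_roundSize (hC : 0 ≤ C) (hk : 1 ≤ k) (hε : 0 < ε) (hε1 : ε < 1) :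
    C / 2 * (k * (p / ε) ^ 2) ≤ roundSize C p k ε := by
  calc C / 2 * (k * (p / ε) ^ 2) = C * (p ^ 2 * k / ε ^ 2 * (1 / 2)) := by ring
    _ ≤ C * (p ^ 2 * k / ε ^ 2 * Real.log (2 * k / ε)) := by
      gcongr
      exact half_le_log_two_mul_div hk hε hε1
    _ ≤ roundSize C p k ε := Nat.le_ceil _

lemma mul_roundSize_le (hC : 0 ≤ C) (hk : 1 ≤ k) (hp : 1 ≤ p) (hε : 0 < ε) (hε1 : ε < 1) :
    (k * roundSize C p k ε : ℝ) ≤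
      (C + 2) * (p ^ 2 * k ^ 2 / ε ^ 2 * Real.log (2 * k / ε)) := by
  have hlog := half_le_log_two_mul_div hk hε hε1
  have hk' : (1 : ℝ) ≤ k := by exact_mod_cast hk
  set L := p ^ 2 * k / ε ^ 2 * Real.log (2 * k / ε)
  have hL : 1 ≤ 2 * L := by
    have hcoeff : 1 ≤ p ^ 2 * k / ε ^ 2 := by
      rw [one_le_div (by positivity)]
      exact (pow_le_one₀ hε.le hε1.le).trans (one_le_mul_of_one_le_of_one_le (one_le_pow₀ hp) hk')
    nlinarith
  calc (k * roundSize C p k ε : ℝ) ≤ k * (C * L + 1) := by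
        gcongr
        exact (Nat.ceil_lt_add_one (mul_nonneg hC (by linarith))).le
    _ ≤ k * ((C + 2) * L) := by
        gcongr
        linarith
    _ = (C + 2) * (p ^ 2 * k ^ 2 / ε ^ 2 * Real.log (2 * k / ε)) := by ring

end RoundSize

end SubspaceOutliers

open SubspaceOutliers in
theorem mainTheorem4_general {n d k N : ℕ} {p ε q : ℝ} (hk : 1 ≤ k) (hp : 1 ≤ p) (hε : 0 < ε)
    (hN : k * (p / ε) ^ 2 ≤ (1 - q) * N) (x : Fin n → Pt d) {V : Submodule ℝ (Pt d)}
    (hV : Module.finrank ℝ V ≤ k) (I : Finset (Fin n)) :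
    ENNReal.ofReal q ≤ (adaptiveSample x p N k).toOuterMeasure {S | IsGood x k p ε V I S} := by
  have hp₀ : 0 < p := by linarith
  have hkp : 0 < k * (p / ε) ^ 2 := by positivity
  have hN₀ : 0 < N := Nat.pos_of_ne_zero (by rintro rfl; exact (hkp.trans_le hN).ne' (by simp))
  have hN' : (0 : ℝ) < N := by exact_mod_cast hN₀
  have hfail : (adaptiveSample x p N k).toOuterMeasure {S | ¬Approximates x k p ε V I S} ≤
      ENNReal.ofReal (1 - q) :=
    calc _ ≤ _ := toOuterMeasure_adaptiveSample_le_round_empty x p N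
          (isLowerSet_setOf_not_approximates x k p ε V I) hk
      _ ≤ ENNReal.ofReal (k * (p / ε) ^ 2 / N) := toOuterMeasure_round_empty_le hp hε hV hN₀ x I
      _ ≤ ENNReal.ofReal (1 - q) := ENNReal.ofReal_le_ofReal ((div_le_iff₀ hN').mpr hN)
  have hq : 0 ≤ 1 - q := nonneg_of_mul_nonneg_left (hkp.le.trans hN) hN'
  calc ENNReal.ofReal q = 1 - ENNReal.ofReal (1 - q) := by
        rw [← ENNReal.ofReal_one, ← ENNReal.ofReal_sub 1 hq, sub_sub_cancel]
    _ ≤ _ := tsub_le_iff_left.mpr ((one_le_toOuterMeasure_not_approximates_add hp₀ hN₀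
        x k ε V I).trans (add_le_add_left hfail _))

end

theorem mainTheorem4 :
    ∃ C C' q : ℝ, 0 < C ∧ 0 < C' ∧ 0 < q ∧
      ∀ (n d k : ℕ) (p ε α : ℝ), 1 ≤ k → k ≤ d → 1 ≤ p → 0 < ε → ε < 1 → 0 ≤ α → α ≤ 1 →
        (k * SubspaceOutliers.roundSize C p k ε : ℝ)
            ≤ C' * (p ^ 2 * k ^ 2 / ε ^ 2 * Real.log (2 * k / ε)) ∧
        ∀ (x : Fin n → SubspaceOutliers.Pt d) (V : Submodule ℝ (SubspaceOutliers.Pt d))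
          (I : Finset (Fin n)), SubspaceOutliers.IsOptimal x k p α V I →
          ENNReal.ofReal q ≤
            (SubspaceOutliers.adaptiveSample x p (SubspaceOutliers.roundSize C p k ε) k).toOuterMeasure
              {S | SubspaceOutliers.IsGood x k p ε V I S} := by
  refine ⟨4, 4 + 2, 2⁻¹, by norm_num, by norm_num, by norm_num, ?_⟩
  intro n d k p ε α hk _ hp hε hε1 _ _
  refine ⟨SubspaceOutliers.mul_roundSize_le zero_le_four hk hp hε hε1, fun x V I hopt =>
    mainTheorem4_general hk hp hε ?_ x hopt.finrank_eq.le I⟩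
  linarith [SubspaceOutliers.mul_div_sq_le_roundSize (C := 4) (p := p) zero_le_four hk hε hε1]
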